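/- Let $X$ be a finite set and let $S:X\times X\to X\times X$, $S(x,y)=(g_x(y),f_y(x))$, be a non-degenerate symmetric set-theoretical solution: all maps $g_x,f_x:X\to X$ are bijective, $S\circ S=\mathrm{Id}$, and $S^{12}S^{23}S^{12}=S^{23}S^{12}S^{23}$ on $X^3$. A pair $(x,y)$ with $S(x,y)=(x,y)$ is called frozen, and $xy$ is then called a frozen element. Let $M(X,S)$ and $G(X,S)$ be the monoid and the group presented by $\langle X\mid xy=g_x(y)f_y(x)\text{ for } x,y\in X,\ S(x,y)\neq(x,y)\rangle$. An element of a monoid is balanced if its left divisors and its right divisors are the same; a Garside element is a balanced element whose divisors generate the monoid. Let $V$ be the real vector space with basis $X$, put $\phi_x=f_x^{-1}$, and let $\psi:G(X,S)\to GL(V)$ be the representation with $\psi_x(x)=-\phi_x(x)$ and $\psi_x(y)=\phi_x(y)$ for $y\in X$, $y\neq x$. Let $W=W(X,S)=\psi(G(X,S))$ and $\mathbf X=\{\psi_x\mid x\in X\}\subseteq W$; write $\psi$ also for the induced morphism $M(X,S)\to W$. For a group $W$ generated as a monoid by a subset $\mathbf X$, let $\ell$ be the word length on $\mathbf X$. If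 $w=vv'$ with $\ell(w)=\ell(v)+\ell(v')$, then $v$ is a left factor and $v'$ a right factor of $w$; $w$ is $\mathbf X$-balanced if its left factors and its right factors are the same, and $\mathrm{Div}_{\mathbf X}(w)$ is then the set of its factors. For such a $w$, $M_{w,\mathbf X}$ is the monoid with generators $\underline v$, $v\in\mathrm{Div}_{\mathbf X}(w)$, and relations $\underline 1=1$ and $\underline v\,\underline{v'}=\underline{v''}$ whenever $v,v',v''\in \mathrm{Div}_{\mathbf X}(w)$, $vv'=v''$ and $\ell(v)+\ell(v')=\ell(v'')$. We say that $(W,\mathbf X)$ is a generating generated section for a monoid $M$ through $w$ if $W$ is finite, $w$ is $\mathbf X$-balanced, $\mathrm{Div}_{\mathbf X}(w)=W$, and $M\cong M_{w,\mathbf X}$. Then $M(X,S)$ has a unique Garside element $\Delta$ that left-divides and right-divides every Garside element; let $\mathrm{Div}(\Delta)$ be its set of divisors. The following are equivalent: 1. $(W(X,S),\mathbf X)$ is a generating generated section for $M(X,S)$ through $\psi(\Delta)$; 2. $\psi(\mathrm{Div}(\Delta))=W(X,S)$; 3. Property $(\mathcal C)$: for every frozen pair $(x,y)$, $g_x\circ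 g_y=\mathrm{Id}_X$ and $f_y\circ f_x=\mathrm{Id}_X$. Moreover, in this case every frozen element $xy$ lies in $\mathrm{Ker}\,\psi$. -/

import Mathlib

noncomputable section

namespace YangBaxter

/-! ## Set-theoretical solutions -/

section Solutions

variable {X : Type*}

/-- The maps `g_x`, defined by `S (x, y) = (g_x y, f_y x)`. -/
def g (S : X × X → X × X) (x y : X) : X := (S (x, y)).1

/-- The maps `f_y`, defined by `S (x, y) = (g_x y, f_y x)`. -/
def f (S : X × X → X × X) (y x : X) : X := (S (x, y)).2

/-- `S` acting on the first and second components of `X ^ 3`. -/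
def act12 (S : X × X → X × X) (t : X × X × X) : X × X × X :=
  ((S (t.1, t.2.1)).1, (S (t.1, t.2.1)).2, t.2.2)

/-- `S` acting on the second and third components of `X ^ 3`. -/
def act23 (S : X × X → X × X) (t : X × X × X) : X × X × X :=
  (t.1, S t.2)

/-- `(X, S)` is a non-degenerate symmetric (that is, involutive and braided) set-theoretical
solution. -/
structure IsNondegenerateSymmetric (S : X × X → X × X) : Prop where
  g_bijective : ∀ x, Function.Bijective (g S x)
  f_bijective : ∀ x, Function.Bijective (f S x)
  involutive : ∀ p, S (S p) = p
  braided : ∀ t, act12 S (act23 S (act12 S t)) = act23 S (act12 S (act23 S t))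

/-- `(x, y)` is a frozen pair. -/
def IsFrozenPair (S : X × X → X × X) (x y : X) : Prop := S (x, y) = (x, y)

/-- Property (C) for `(X, S)`: it holds for each frozen pair. -/
def PropertyC (S : X × X → X × X) : Prop :=
  ∀ x y, IsFrozenPair S x y → g S x ∘ g S y = id ∧ f S y ∘ f S x = id

/-! ## The structure monoid `M(X,S)` and the structure group `G(X,S)` -/

/-- The relations `x y = g_x(y) f_y(x)`, for `S (x, y) ≠ (x, y)`, between words on `X`. -/
def monoidRels (S : X × X → X × X) (u v : FreeMonoid X) : Prop :=
  ∃ x y, S (x, y) ≠ (x, y) ∧ u = FreeMonoid.of x * FreeMonoid.of y ∧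
    v = FreeMonoid.of (g S x y) * FreeMonoid.of (f S y x)

/-- The same relations in the free group on `X`, written as relators. -/
def groupRels (S : X × X → X × X) : Set (FreeGroup X) :=
  {r | ∃ x y, S (x, y) ≠ (x, y) ∧ r = (FreeGroup.of x * FreeGroup.of y) *
    (FreeGroup.of (g S x y) * FreeGroup.of (f S y x))⁻¹}

/-- The structure monoid `M(X,S)`. -/
abbrev StructureMonoid (S : X × X → X × X) : Type _ := PresentedMonoid (monoidRels S)

/-- The structure group `G(X,S)`. -/
abbrev StructureGroup (S : X × X → X × X) : Type _ := PresentedGroup (groupRels S)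

/-- The canonical morphism from `M(X,S)` to its enveloping group `G(X,S)`. -/
def toStructureGroup (S : X × X → X × X) : StructureMonoid S →* StructureGroup S :=
  PresentedMonoid.lift (fun x => (PresentedGroup.of x : StructureGroup S)) (by
    rintro a b ⟨x, y, hxy, rfl, rfl⟩
    have h : (PresentedGroup.mk (groupRels S)) ((FreeGroup.of x * FreeGroup.of y) *
        (FreeGroup.of (g S x y) * FreeGroup.of (f S y x))⁻¹) = 1 :=
      PresentedGroup.one_of_mem ⟨x, y, hxy, rfl⟩
    rw [map_mul, map_inv, mul_inv_eq_one, map_mul, map_mul] at h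
    simpa [PresentedGroup.of] using h)

end Solutions

/-! ## Garside elements -/

section Garside

variable {M : Type*} [Monoid M]

/-- The set of left divisors of an element; it is `Div(a)` when `a` is balanced. -/
def leftDivisors (a : M) : Set M := {b | ∃ c, a = b * c}

/-- The set of right divisors of an element. -/
def rightDivisors (a : M) : Set M := {b | ∃ c, a = c * b}

/-- `Δ` is balanced and its divisors generate the monoid. -/
def IsGarsideElement (Δ : M) : Prop :=
  leftDivisors Δ = rightDivisors Δ ∧ Submonoid.closure (leftDivisors Δ) = ⊤

/-- `Δ` is "the" Garside element: the least Garside element, for left and right divisibility. -/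
def IsLeastGarsideElement (Δ : M) : Prop :=
  IsGarsideElement Δ ∧
    ∀ Δ' : M, IsGarsideElement Δ' → Δ ∈ leftDivisors Δ' ∧ Δ ∈ rightDivisors Δ'

end Garside

/-! ## Generated groups -/

section GeneratedGroups

variable {W : Type*} [Group W]

/-- The length of `w` on `A`: the minimal length of a word on `A` representing `w` (it is used only
when `A` generates `W` as a monoid). -/
def length (A : Set W) (w : W) : ℕ :=
  sInf {k | ∃ l : List W, (∀ a ∈ l, a ∈ A) ∧ l.prod = w ∧ l.length = k}

/-- The set of left `A`-factors of `w`. -/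
def leftFactors (A : Set W) (w : W) : Set W :=
  {v | ∃ v', w = v * v' ∧ length A w = length A v + length A v'}

/-- The set of right `A`-factors of `w`. -/
def rightFactors (A : Set W) (w : W) : Set W :=
  {v | ∃ v', w = v' * v ∧ length A w = length A v' + length A v}

/-- The defining relations `v v' = v''` of the monoid `M_{w,A}`. The copy of the factor `1` of `w`
stands for the neutral element of the monoid, which is the first constructor. -/
inductive FactorRel (A : Set W) (w : W) :
    FreeMonoid (leftFactors A w) → FreeMonoid (leftFactors A w) → Prop
  | one (e : leftFactors A w) (he : (e : W) = 1) : FactorRel A w (FreeMonoid.of e) 1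
  | mul (v v' v'' : leftFactors A w) (h : (v : W) * v' = v'')
      (hl : length A (v : W) + length A (v' : W) = length A (v'' : W)) :
      FactorRel A w (FreeMonoid.of v * FreeMonoid.of v') (FreeMonoid.of v'')

/-- The monoid `M_{w,A}` (for an `A`-balanced element `w`). -/
abbrev FactorMonoid (A : Set W) (w : W) : Type _ := PresentedMonoid (FactorRel A w)

/-- `(W, A)` is a generating generated group for the monoid `M`, through the `A`-balanced
element `w`. -/
structure IsGeneratingGeneratedGroup (A : Set W) (w : W) (M : Type*) [Monoid M] : Prop where
  finite : Finite W
  generates : Submonoid.closure A = ⊤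
  balanced : leftFactors A w = rightFactors A w
  factors_generate : Subgroup.closure (leftFactors A w) = ⊤
  iso : Nonempty (M ≃* FactorMonoid A w)

/-- `(W, A)` is a generating generated section for the monoid `M`, through the `A`-balanced
element `w`: furthermore every element of `W` is a factor of `w`. -/
structure IsGeneratingGeneratedSection (A : Set W) (w : W) (M : Type*) [Monoid M] : Prop
    extends IsGeneratingGeneratedGroup A w M where
  factors_eq_univ : leftFactors A w = Set.univ

end GeneratedGroups

/-! ## The representation `ψ` and the group `W(X,S)` -/

section Representation

variable {X : Type*} {S : X × X → X × X}

/-- The permutation `φ_x = f_x⁻¹` of `X`. -/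
def phi (hS : IsNondegenerateSymmetric S) (x : X) : Equiv.Perm X :=
  (Equiv.ofBijective (f S x) (hS.f_bijective x)).symm

open Classical in
/-- The sign of `ψ_x` at the basis vector `y`. -/
def psiSign (x y : X) : ℝ := if y = x then -1 else 1

lemma psiSign_mul_self (x y : X) : psiSign x y * psiSign x y = 1 := by
  unfold psiSign; split_ifs <;> norm_num

/-- The linear automorphism `ψ_x` of the real vector space `V = X →₀ ℝ` with basis `X`: it maps the
basis vector `y` to `φ_x(y)` if `y ≠ x`, and the basis vector `x` to `-φ_x(x)`. -/
def psiGen (hS : IsNondegenerateSymmetric S) (x : X) : (X →₀ ℝ) ≃ₗ[ℝ] (X →₀ ℝ) :=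
  LinearEquiv.ofLinearMap
    (Finsupp.linearCombination ℝ fun y => Finsupp.single (phi hS x y) (psiSign x y))
    (Finsupp.linearCombination ℝ fun z =>
      Finsupp.single ((phi hS x).symm z) (psiSign x ((phi hS x).symm z)))
    (by
      ext1 z
      ext1
      simp [psiSign_mul_self])
    (by
      ext1 z
      ext1
      simp [psiSign_mul_self])

lemma psiGen_single (hS : IsNondegenerateSymmetric S) (x y : X) (c : ℝ) :
    psiGen hS x (Finsupp.single y c) = Finsupp.single (phi hS x y) (c * psiSign x y) := by
  simp [psiGen]

lemma phi_mul (hS : IsNondegenerateSymmetric S) (x y : X) :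
    phi hS x * phi hS y = phi hS (g S x y) * phi hS (f S y x) := by
  have key : ∀ t, f S y (f S x t) = f S (f S y x) (f S (g S x y) t) := fun t => by
    have h := congrArg (fun p => p.2.2) (hS.braided (t, x, y))
    simpa [act12, act23, f, g] using h
  apply Equiv.ext
  intro z
  simp only [Equiv.Perm.mul_apply]
  rw [← Equiv.symm_apply_eq, ← Equiv.symm_apply_eq]
  have e : ∀ a b, (phi hS a).symm b = f S a b := fun _ _ => rfl
  have e' : ∀ a b, f S a (phi hS a b) = b := fun a b => (phi hS a).symm_apply_apply b
  rw [e, e, ← key, e', e']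

lemma phi_eq_iff (hS : IsNondegenerateSymmetric S) (x y z : X) :
    phi hS y z = x ↔ z = f S y x := by
  unfold phi
  rw [Equiv.symm_apply_eq]; rfl

lemma psiGen_mul (hS : IsNondegenerateSymmetric S) (x y : X) :
    psiGen hS x * psiGen hS y = psiGen hS (g S x y) * psiGen hS (f S y x) := by
  have hinv : f S (f S y x) (g S x y) = y := by
    have h := congrArg Prod.snd (hS.involutive (x, y))
    simpa [f, g] using h
  apply LinearEquiv.toLinearMap_injective
  ext1 z
  ext1
  have h := Equiv.congr_fun (phi_mul hS x y) z
  simp only [Equiv.Perm.mul_apply] at h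
  have e1 : psiSign x (phi hS y z) = psiSign (f S y x) z := by
    unfold psiSign
    congr 1
    exact propext (phi_eq_iff hS x y z)
  have e2 : psiSign (g S x y) (phi hS (f S y x) z) = psiSign y z := by
    unfold psiSign
    congr 1
    exact propext ((phi_eq_iff hS _ _ z).trans (by rw [hinv]))
  simp [psiGen_single, h, e1, e2, mul_comm]

/-- The representation `ψ : G(X,S) → GL(V)`, with `x ↦ ψ_x`. -/
def psi (hS : IsNondegenerateSymmetric S) :
    StructureGroup S →* ((X →₀ ℝ) ≃ₗ[ℝ] (X →₀ ℝ)) :=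
  PresentedGroup.toGroup (f := psiGen hS) (by
    rintro r ⟨x, y, -, rfl⟩
    simp only [map_mul, map_inv, FreeGroup.lift_apply_of, mul_inv_eq_one]
    exact psiGen_mul hS x y)

/-- The group `W(X,S)`, the image of `ψ` in `GL(V)`. -/
def groupW (hS : IsNondegenerateSymmetric S) : Subgroup ((X →₀ ℝ) ≃ₗ[ℝ] (X →₀ ℝ)) :=
  (psi hS).range

/-- The morphism `ψ : M(X,S) → W(X,S)`. -/
def psiMonoid (hS : IsNondegenerateSymmetric S) : StructureMonoid S →* groupW hS :=
  (psi hS).rangeRestrict.comp (toStructureGroup S)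

/-- The generating set `{ψ_x | x ∈ X}` of `W(X,S)`. -/
def generatorsW (hS : IsNondegenerateSymmetric S) : Set (groupW hS) :=
  Set.range fun x => psiMonoid hS (PresentedMonoid.of (monoidRels S) x)

end Representation

end YangBaxter

end

/-! Following how a word permutes `X` gives a bijective cocycle `exponents : M(X,S) → ℕ^X` with
`exponents (m * m') y = exponents m (perm m' y) + exponents m' y`. Through it right divisibility
becomes the coordinatewise order (`mem_rightDivisors_iff`), and the least Garside element is the one
with all exponents `1`. Its divisors, on either side, are the simple elements, those with exponents
at most `1`.

By `psi_single`, `ψ m` is the permutation matrix of `perm m` with signs `(-1)^exponents`. It thus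
records exactly `perm m` and the exponents mod 2, so `ψ` is injective on simple elements, and a
simple element is the shortest one in its fibre.

The question is whether simple elements fill `W`. The frozen pairs are the `(φ_y(y), y)`, and the
product has exponent vector twice the basis vector at `y`. So it is killed by `ψ` as soon as its
permutation is trivial, which is property (C) by `propertyC_iff`. Under (C), frozen right factors
can be stripped from a non-simple element without changing its image. Conversely, a simple element
with the same image as a frozen one has even exponents, hence is `1`. Lengths in `W` then match
sizes of simple elements, which yields the section. -/

namespace YangBaxter

/-! ### The bijective cocycle from `M(X,S)` to `ℕ^X`. -/

section StructureMonoidNormalForm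

variable {X : Type*} {S : X × X → X × X} (hS : IsNondegenerateSymmetric S)

/-- The generator of `M(X,S)` attached to `x`. -/
abbrev gen (S : X × X → X × X) (x : X) : StructureMonoid S := PresentedMonoid.of (monoidRels S) x

lemma gen_mul_gen (x y : X) : gen S x * gen S y = gen S (g S x y) * gen S (f S y x) := by
  by_cases h : S (x, y) = (x, y)
  · simp [g, f, h]
  · exact PresentedMonoid.mk_eq_mk_of_rel ⟨x, y, h, rfl, rfl⟩

lemma gen_induction {p : StructureMonoid S → Prop} (one : p 1)
    (mul : ∀ x m, p m → p (gen S x * m)) (m : StructureMonoid S) : p m := by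
  obtain ⟨w, rfl⟩ := PresentedMonoid.surjective_mk m
  induction w using FreeMonoid.inductionOn' with
  | one => exact one
  | of_mul x w ih => rw [map_mul]; exact mul x _ ih

include hS in
lemma f_f_g (x y : X) : f S (f S y x) (g S x y) = y := by
  have h := congrArg Prod.snd (hS.involutive (x, y))
  simpa [f, g] using h

lemma f_phi (x y : X) : f S y (phi hS y x) = x := ((phi_eq_iff hS _ _ _).1 rfl).symm

lemma phi_f_eq_g (x y : X) : phi hS (f S y x) y = g S x y :=
  (phi_eq_iff hS _ _ _).2 (f_f_g hS x y).symm

lemma gen_phi_mul_gen (u v : X) :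
    gen S (phi hS u v) * gen S u = gen S (phi hS v u) * gen S v := by
  have h := gen_mul_gen (S := S) (phi hS u v) u
  rw [f_phi] at h
  rw [h]
  have h2 := phi_f_eq_g hS (phi hS u v) u
  rw [f_phi] at h2
  rw [h2]

/-- The permutation part `M(X,S) → Sym(X)`, `x ↦ φ_x`. -/
noncomputable def perm : StructureMonoid S →* Equiv.Perm X :=
  PresentedMonoid.lift (phi hS) (by
    rintro a b ⟨x, y, -, rfl, rfl⟩
    simpa using phi_mul hS x y)

@[simp] lemma perm_gen (x : X) : perm hS (gen S x) = phi hS x := rfl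

/-- The action of a generator on `Sym(X) × ℕ ^ X`. -/
noncomputable def genAction (x : X) : Function.End (Equiv.Perm X × (X →₀ ℕ)) :=
  fun p => (phi hS x * p.1, p.2 + Finsupp.single (p.1⁻¹ x) 1)

/-- Up to the permutation `p.1⁻¹`, both sides add the basis vectors at `y` and at `f_y(x)`, in
opposite orders. -/
lemma genAction_mul (x y : X) : genAction hS x * genAction hS y =
    genAction hS (g S x y) * genAction hS (f S y x) := by
  funext p
  have h1 : (phi hS y)⁻¹ x = f S y x := rfl
  have h2 : (phi hS (f S y x))⁻¹ (g S x y) = y := f_f_g hS x y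
  change genAction hS x (genAction hS y p) = genAction hS (g S x y) (genAction hS (f S y x) p)
  simp only [genAction, mul_inv_rev, Equiv.Perm.mul_apply, h1, h2, ← mul_assoc, phi_mul hS x y]
  rw [add_right_comm]

/-- The left action of `M(X,S)` on `Sym(X) × ℕ ^ X`. -/
noncomputable def action : StructureMonoid S →* Function.End (Equiv.Perm X × (X →₀ ℕ)) :=
  PresentedMonoid.lift (genAction hS) (by
    rintro a b ⟨x, y, -, rfl, rfl⟩
    simpa using genAction_mul hS x y)

/-- The bijective cocycle `M(X,S) → ℕ ^ X`. -/
noncomputable def exponents (m : StructureMonoid S) : X →₀ ℕ := (action hS m (1, 0)).2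

lemma action_gen_mul (x : X) (m : StructureMonoid S) (p) :
    action hS (gen S x * m) p = genAction hS x (action hS m p) := by
  rw [map_mul]; rfl

lemma action_fst (m : StructureMonoid S) : (action hS m (1, 0)).1 = perm hS m := by
  induction m using gen_induction with
  | one => simp [Function.End.one_def]
  | mul x m ih => rw [action_gen_mul, map_mul, perm_gen, ← ih]; rfl

@[simp] lemma exponents_one : exponents hS 1 = 0 := by
  simp [exponents, Function.End.one_def]

lemma exponents_gen_mul (x : X) (m : StructureMonoid S) :
    exponents hS (gen S x * m) = exponents hS m + Finsupp.single ((perm hS m)⁻¹ x) 1 := by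
  rw [exponents, action_gen_mul, ← action_fst]; rfl

lemma exponents_gen (x : X) : exponents hS (gen S x) = Finsupp.single x 1 := by
  have := exponents_gen_mul hS x 1
  simpa using this

lemma exponents_mul (m m' : StructureMonoid S) (y : X) :
    exponents hS (m * m') y = exponents hS m (perm hS m' y) + exponents hS m' y := by
  classical
  induction m using gen_induction with
  | one => simp
  | mul x m ih =>
    rw [mul_assoc, exponents_gen_mul, exponents_gen_mul, Finsupp.add_apply, Finsupp.add_apply, ih,
      map_mul, Finsupp.single_apply, Finsupp.single_apply, mul_inv_rev, Equiv.Perm.mul_apply,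
      Equiv.Perm.inv_eq_iff_eq]
    simp only [eq_comm]
    omega

lemma exponents_gen_perm_mul (y : X) (m : StructureMonoid S) :
    exponents hS (gen S (perm hS m y) * m) = exponents hS m + Finsupp.single y 1 := by
  simp [exponents_gen_mul]

lemma exists_exponents_mul_eq (m : StructureMonoid S) (d : X →₀ ℕ) :
    ∃ c, exponents hS (c * m) = exponents hS m + d := by
  induction d using Finsupp.induction_linear generalizing m with
  | zero => exact ⟨1, by simp⟩
  | add d e hd he =>
    obtain ⟨c, hc⟩ := hd m
    obtain ⟨c', hc'⟩ := he (c * m)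
    exact ⟨c' * c, by rw [mul_assoc, hc', hc, add_assoc]⟩
  | single y k =>
    induction k with
    | zero => exact ⟨1, by simp⟩
    | succ k ih =>
      obtain ⟨c, hc⟩ := ih
      exact ⟨gen S (perm hS (c * m) y) * c, by
        rw [mul_assoc, exponents_gen_perm_mul, hc, add_assoc, Finsupp.single_add]⟩

lemma exponents_surjective : Function.Surjective (exponents hS) := by
  intro a
  obtain ⟨c, hc⟩ := exists_exponents_mul_eq hS 1 a
  exact ⟨c * 1, by simpa using hc⟩

/-- The length on `M(X,S)`. -/
noncomputable def size (m : StructureMonoid S) : ℕ := (exponents hS m).degree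

@[simp] lemma size_one : size hS 1 = 0 := by simp [size]

@[simp] lemma size_gen_mul (x : X) (m : StructureMonoid S) :
    size hS (gen S x * m) = size hS m + 1 := by
  simp [size, exponents_gen_mul]

lemma size_mul (m m' : StructureMonoid S) : size hS (m * m') = size hS m + size hS m' := by
  induction m using gen_induction with
  | one => simp
  | mul x m ih => rw [mul_assoc, size_gen_mul, size_gen_mul, ih]; omega

lemma size_gen (x : X) : size hS (gen S x) = 1 := by simpa using size_gen_mul hS x 1

lemma eq_one_of_exponents_eq_zero {m : StructureMonoid S} (h : exponents hS m = 0) : m = 1 := by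
  induction m using gen_induction with
  | one => rfl
  | mul x m ih =>
    have h1 := size_gen_mul hS x m
    rw [size, h] at h1
    simp at h1

lemma eq_one_of_size_eq_zero {m : StructureMonoid S} (h : size hS m = 0) : m = 1 :=
  eq_one_of_exponents_eq_zero hS ((Finsupp.degree_eq_zero_iff _).1 h)

/-- A diamond argument by induction on size: if the first letters add different basis vectors `p`
and `q`, both words are compared with extensions of a common `r`, and one defining relation
exchanges the two added letters. -/
lemma exponents_injective : Function.Injective (exponents hS) := by
  suffices H : ∀ k, ∀ m n : StructureMonoid S, size hS m = k →
      exponents hS m = exponents hS n → m = n from fun m n h => H _ m n rfl h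
  intro k
  induction k with
  | zero =>
    intro m n hm h
    rw [eq_one_of_size_eq_zero hS hm] at h ⊢
    exact (eq_one_of_exponents_eq_zero hS (by simpa using h.symm)).symm
  | succ k IH =>
    intro m n hm h
    induction m using gen_induction with
    | one => simp at hm
    | mul x m _ =>
    induction n using gen_induction with
    | one => exact eq_one_of_exponents_eq_zero hS (by simpa using h)
    | mul y n _ =>
    have hm' : size hS m = k := by simpa using hm
    have hn' : size hS n = k := by
      have : size hS (gen S y * n) = k + 1 := by rw [size, ← h]; exact hm
      simpa using this
    obtain ⟨p, rfl⟩ : ∃ p, perm hS m p = x := (perm hS m).surjective x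
    obtain ⟨q, rfl⟩ : ∃ q, perm hS n q = y := (perm hS n).surjective y
    rw [exponents_gen_perm_mul, exponents_gen_perm_mul] at h
    by_cases hpq : p = q
    · subst hpq
      rw [IH m n hm' (add_right_cancel h)]
    · have hle : Finsupp.single q 1 ≤ exponents hS m := by
        rw [Finsupp.single_le_iff]
        have := DFunLike.congr_fun h q
        simp [hpq] at this
        omega
      obtain ⟨a, ha⟩ := exists_add_of_le hle
      -- The exponents of `r` are the common ones with both `p` and `q` removed.
      obtain ⟨r, rfl⟩ := exponents_surjective hS a
      have hn : exponents hS n = exponents hS r + Finsupp.single p 1 := by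
        apply add_right_cancel (b := Finsupp.single q 1)
        rw [← h, ha]
        abel
      have em : m = gen S (perm hS r q) * r :=
        IH _ _ hm' (by rw [exponents_gen_perm_mul, ha, add_comm])
      have en : n = gen S (perm hS r p) * r :=
        IH _ _ hn' (by rw [exponents_gen_perm_mul, hn])
      rw [em, en, ← mul_assoc, ← mul_assoc]
      congr 1
      simp only [map_mul, perm_gen, Equiv.Perm.mul_apply]
      exact gen_phi_mul_gen hS _ _

lemma mem_rightDivisors_iff (b a : StructureMonoid S) :
    b ∈ rightDivisors a ↔ exponents hS b ≤ exponents hS a := by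
  constructor
  · rintro ⟨c, rfl⟩ y
    rw [exponents_mul]
    exact Nat.le_add_left _ _
  · intro h
    obtain ⟨d, hd⟩ := exists_add_of_le h
    obtain ⟨c, hc⟩ := exists_exponents_mul_eq hS b d
    exact ⟨c, exponents_injective hS (by rw [hd, hc])⟩

include hS in
lemma mul_left_cancel' {m c c' : StructureMonoid S} (h : m * c = m * c') : c = c' := by
  -- Equal permutations make the contributions of `m` to the two exponent vectors coincide.
  have hp : perm hS c = perm hS c' := by
    have := congrArg (perm hS) h
    simpa using this
  apply exponents_injective hS
  ext y
  have := DFunLike.congr_fun (congrArg (exponents hS) h) y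
  rw [exponents_mul, exponents_mul, hp] at this
  omega

end StructureMonoidNormalForm

/-! ### What `ψ` remembers, and lengths in `W`. -/

section Parity

variable {X : Type*} {S : X × X → X × X} (hS : IsNondegenerateSymmetric S)

lemma psi_single (m : StructureMonoid S) (y : X) (c : ℝ) :
    psi hS (toStructureGroup S m) (Finsupp.single y c) =
      Finsupp.single (perm hS m y) (c * (-1) ^ exponents hS m y) := by
  classical
  induction m using gen_induction with
  | one => simp
  | mul x m ih =>
    have hx : psi hS (toStructureGroup S (gen S x)) = psiGen hS x := PresentedGroup.toGroup.of _
    have hiff : (perm hS m)⁻¹ x = y ↔ perm hS m y = x := by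
      rw [Equiv.Perm.inv_eq_iff_eq, eq_comm]
    rw [map_mul, map_mul, LinearEquiv.mul_apply, ih, hx, psiGen_single, map_mul, perm_gen,
      exponents_gen_mul, Finsupp.add_apply, Finsupp.single_apply]
    simp only [hiff, psiSign, Equiv.Perm.mul_apply]
    split_ifs <;> simp [pow_succ]

lemma psiMonoid_eq_iff (m n : StructureMonoid S) : psiMonoid hS m = psiMonoid hS n ↔
    perm hS m = perm hS n ∧ ∀ y, exponents hS m y % 2 = exponents hS n y % 2 := by
  have h0 : psiMonoid hS m = psiMonoid hS n ↔
      psi hS (toStructureGroup S m) = psi hS (toStructureGroup S n) := Subtype.ext_iff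
  rw [h0]
  constructor
  · intro h
    have key : ∀ y, perm hS m y = perm hS n y ∧ exponents hS m y % 2 = exponents hS n y % 2 := by
      intro y
      have h1 := DFunLike.congr_fun h (Finsupp.single y 1)
      rw [psi_single, psi_single, Finsupp.single_eq_single_iff] at h1
      rcases h1 with ⟨h1, h2⟩ | ⟨h1, -⟩
      · refine ⟨h1, ?_⟩
        rw [neg_one_pow_eq_pow_mod_two, neg_one_pow_eq_pow_mod_two (n := exponents hS n y)] at h2
        rcases Nat.mod_two_eq_zero_or_one (exponents hS m y) with h3 | h3 <;>
        rcases Nat.mod_two_eq_zero_or_one (exponents hS n y) with h4 | h4 <;>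
        rw [h3, h4] at h2 ⊢ <;> norm_num at h2
      · simp at h1
    exact ⟨Equiv.ext fun y => (key y).1, fun y => (key y).2⟩
  · rintro ⟨h1, h2⟩
    apply LinearEquiv.toLinearMap_injective
    ext1 y
    ext1
    simp only [LinearMap.comp_apply, Finsupp.lsingle_apply, LinearEquiv.coe_coe, psi_single, h1]
    rw [neg_one_pow_eq_pow_mod_two, neg_one_pow_eq_pow_mod_two (n := exponents hS n y), h2]

/-- An element of `M(X,S)` all of whose exponents are at most `1`. -/
def IsSimple (m : StructureMonoid S) : Prop := ∀ y, exponents hS m y ≤ 1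

variable {hS}

/-- Exponents `0` and `1` are the least natural numbers in their classes mod 2. -/
lemma IsSimple.exponents_le {m n : StructureMonoid S} (hm : IsSimple hS m)
    (h : psiMonoid hS m = psiMonoid hS n) : exponents hS m ≤ exponents hS n := by
  intro y
  have h1 := ((psiMonoid_eq_iff hS m n).1 h).2 y
  have h2 := hm y
  omega

lemma IsSimple.eq_of_size_le {m n : StructureMonoid S} (hm : IsSimple hS m)
    (h : psiMonoid hS m = psiMonoid hS n) (hs : size hS n ≤ size hS m) : m = n := by
  obtain ⟨d, hd⟩ := exists_add_of_le (hm.exponents_le h)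
  have h1 : d.degree = 0 := by
    rw [size, size, hd, map_add] at hs
    omega
  apply exponents_injective hS
  rw [hd, (Finsupp.degree_eq_zero_iff d).1 h1, add_zero]

lemma IsSimple.size_le {m n : StructureMonoid S} (hm : IsSimple hS m)
    (h : psiMonoid hS m = psiMonoid hS n) : size hS m ≤ size hS n := by
  by_contra! hlt
  rw [hm.eq_of_size_le h hlt.le] at hlt
  exact lt_irrefl _ hlt

lemma IsSimple.eq {m n : StructureMonoid S} (hm : IsSimple hS m) (hn : IsSimple hS n)
    (h : psiMonoid hS m = psiMonoid hS n) : m = n :=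
  hm.eq_of_size_le h (hn.size_le h.symm)

lemma IsSimple.of_mul_left {m n : StructureMonoid S} (h : IsSimple hS (m * n)) :
    IsSimple hS m := by
  intro y
  obtain ⟨z, rfl⟩ := (perm hS n).surjective y
  have := h z
  rw [exponents_mul] at this
  omega

lemma IsSimple.of_mul_right {m n : StructureMonoid S} (h : IsSimple hS (m * n)) :
    IsSimple hS n := by
  intro y
  have := h y
  rw [exponents_mul] at this
  omega

variable (hS)

lemma isSimple_gen (x : X) : IsSimple hS (gen S x) := by
  classical
  intro y
  rw [exponents_gen, Finsupp.single_apply]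
  split_ifs <;> simp

lemma isSimple_one : IsSimple hS 1 := by
  intro y
  simp

lemma psiMonoid_gen_mem (x : X) : psiMonoid hS (gen S x) ∈ generatorsW hS := ⟨x, rfl⟩

/-- Words on the generators of `W` lift letter by letter to `M(X,S)`, where word length is `size`.
-/
lemma length_eq_sInf (w : groupW hS) :
    length (generatorsW hS) w = sInf {k | ∃ m, psiMonoid hS m = w ∧ size hS m = k} := by
  have h1 : ∀ m : StructureMonoid S, ∃ l : List (groupW hS), (∀ a ∈ l, a ∈ generatorsW hS) ∧
      l.prod = psiMonoid hS m ∧ l.length = size hS m := by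
    intro m
    induction m using gen_induction with
    | one => exact ⟨[], by simp⟩
    | mul x m ih =>
      obtain ⟨l, hl, hp, hk⟩ := ih
      refine ⟨psiMonoid hS (gen S x) :: l, ?_, by simp [hp], by simp [hk]⟩
      rintro a (_ | ⟨_, ha⟩)
      exacts [psiMonoid_gen_mem hS x, hl a ha]
  have h2 : ∀ l : List (groupW hS), (∀ a ∈ l, a ∈ generatorsW hS) →
      ∃ m, psiMonoid hS m = l.prod ∧ size hS m = l.length := by
    intro l
    induction l with
    | nil => exact fun _ => ⟨1, by simp⟩
    | cons a l ih =>
      intro hl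
      obtain ⟨m, hp, hk⟩ := ih fun b hb => hl b (List.mem_cons_of_mem _ hb)
      obtain ⟨x, rfl⟩ := hl a List.mem_cons_self
      exact ⟨gen S x * m, by simp [hp], by simp [hk]⟩
  unfold length
  congr 1
  ext k
  constructor
  · rintro ⟨l, hl, rfl, rfl⟩
    exact h2 l hl
  · rintro ⟨m, rfl, rfl⟩
    exact h1 m

lemma length_psiMonoid_le (m : StructureMonoid S) :
    length (generatorsW hS) (psiMonoid hS m) ≤ size hS m := by
  rw [length_eq_sInf]
  exact Nat.sInf_le ⟨m, rfl, rfl⟩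

lemma exists_size_eq_length (m : StructureMonoid S) :
    ∃ n, psiMonoid hS n = psiMonoid hS m ∧
      size hS n = length (generatorsW hS) (psiMonoid hS m) := by
  rw [length_eq_sInf]
  exact Nat.sInf_mem (s := {k | ∃ n, psiMonoid hS n = psiMonoid hS m ∧ size hS n = k})
    ⟨_, m, rfl, rfl⟩

variable {hS} in
lemma IsSimple.length_eq {m : StructureMonoid S} (hm : IsSimple hS m) :
    length (generatorsW hS) (psiMonoid hS m) = size hS m := by
  obtain ⟨n, hn, hk⟩ := exists_size_eq_length hS m
  exact le_antisymm (length_psiMonoid_le hS m) (hk ▸ hm.size_le hn.symm)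

lemma closure_generatorsW_eq_top_iff :
    Submonoid.closure (generatorsW hS) = ⊤ ↔ Function.Surjective (psiMonoid hS) := by
  have h : generatorsW hS = psiMonoid hS '' Set.range (PresentedMonoid.of (monoidRels S)) := by
    rw [← Set.range_comp]; rfl
  rw [h, ← MonoidHom.map_mclosure, PresentedMonoid.closure_range_of, ← MonoidHom.mrange_eq_map,
    MonoidHom.mrange_eq_top]

end Parity

/-! ### The least Garside element and its divisors. -/

section GarsideElement

variable {X : Type*} {S : X × X → X × X} {hS : IsNondegenerateSymmetric S}
  {Δ : StructureMonoid S}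

lemma rightDivisors_eq_isSimple (hΔ : ∀ y, exponents hS Δ y = 1) :
    rightDivisors Δ = {m | IsSimple hS m} := by
  ext m
  rw [mem_rightDivisors_iff hS, Finsupp.le_def]
  simp [hΔ, IsSimple]

lemma leftDivisors_subset_isSimple (hΔ : ∀ y, exponents hS Δ y = 1) :
    leftDivisors Δ ⊆ {m | IsSimple hS m} := by
  rintro m ⟨c, rfl⟩
  exact IsSimple.of_mul_left (n := c) fun y => (hΔ y).le

variable [Finite X]

variable (hS) in
lemma finite_isSimple : {m : StructureMonoid S | IsSimple hS m}.Finite := by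
  apply Set.Finite.of_finite_image (f := fun m => (exponents hS m : X → ℕ))
  · apply (Set.Finite.pi' (t := fun _ => Set.Iic 1) fun _ => Set.finite_Iic 1).subset
    rintro _ ⟨m, hm, rfl⟩ y
    exact hm y
  · intro m _ n _ h
    exact exponents_injective hS (DFunLike.coe_injective h)

lemma leftDivisors_eq_isSimple (hΔ : ∀ y, exponents hS Δ y = 1) :
    leftDivisors Δ = {m | IsSimple hS m} := by
  refine (leftDivisors_subset_isSimple hΔ).antisymm ?_
  -- Sending a right divisor to its complement in `Δ` is an injective self-map of the finite set of
  -- simple elements, hence onto: each simple element is also a left divisor.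
  have hex : ∀ c : {m | IsSimple hS m}, ∃ m : {m | IsSimple hS m}, Δ = m.1 * c.1 := by
    rintro ⟨c, hc⟩
    rw [← rightDivisors_eq_isSimple hΔ] at hc
    obtain ⟨m, hm⟩ := hc
    exact ⟨⟨m, leftDivisors_subset_isSimple hΔ ⟨c, hm⟩⟩, hm⟩
  choose h hh using hex
  have hinj : Function.Injective h := by
    intro c c' e
    exact Subtype.ext (mul_left_cancel' hS (m := h c) (by rw [← hh, e, ← hh]))
  have : Finite {m | IsSimple hS m} := finite_isSimple hS
  intro m hm
  obtain ⟨c, hc⟩ := Finite.surjective_of_injective hinj ⟨m, hm⟩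
  exact ⟨c.1, by rw [hh c, hc]⟩

lemma isGarsideElement_of_exponents (hΔ : ∀ y, exponents hS Δ y = 1) : IsGarsideElement Δ := by
  refine ⟨by rw [leftDivisors_eq_isSimple hΔ, rightDivisors_eq_isSimple hΔ], ?_⟩
  rw [leftDivisors_eq_isSimple hΔ, eq_top_iff, ← PresentedMonoid.closure_range_of]
  apply Submonoid.closure_mono
  rintro _ ⟨x, rfl⟩
  exact isSimple_gen hS x

-- Generators have size `1`, so they are not products of two nontrivial elements and lie in every
-- generating set, in particular among the divisors of `Δ`.
omit [Finite X] in
include hS in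
lemma IsGarsideElement.gen_mem_rightDivisors (h : IsGarsideElement Δ) (y : X) :
    gen S y ∈ rightDivisors Δ := by
  by_contra hy
  have key : ∀ m ∈ Submonoid.closure (leftDivisors Δ), m ≠ gen S y := by
    intro m hm
    induction hm using Submonoid.closure_induction with
    | mem m hm =>
      rintro rfl
      exact hy (h.1 ▸ hm)
    | one =>
      intro e
      have := congrArg (size hS) e
      simp [size_gen] at this
    | mul m n _ _ hm hn =>
      intro e
      have := congrArg (size hS) e
      rw [size_mul, size_gen] at this
      rcases Nat.eq_zero_or_pos (size hS m) with h0 | h0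
      · rw [eq_one_of_size_eq_zero hS h0, one_mul] at e
        exact hn e
      · rw [eq_one_of_size_eq_zero hS (m := n) (by omega), mul_one] at e
        exact hm e
  exact key (gen S y) (h.2 ▸ Submonoid.mem_top _) rfl

omit [Finite X] in
variable (hS) in
lemma IsGarsideElement.one_le_exponents (h : IsGarsideElement Δ) (y : X) :
    1 ≤ exponents hS Δ y := by
  have := (mem_rightDivisors_iff hS _ _).1 (h.gen_mem_rightDivisors (hS := hS) y) y
  simpa [exponents_gen] using this

lemma isLeastGarsideElement_of_exponents (hΔ : ∀ y, exponents hS Δ y = 1) :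
    IsLeastGarsideElement Δ := by
  refine ⟨isGarsideElement_of_exponents hΔ, fun Δ' h => ?_⟩
  have : Δ ∈ rightDivisors Δ' :=
    (mem_rightDivisors_iff hS _ _).2 fun y => by rw [hΔ]; exact h.one_le_exponents hS y
  exact ⟨h.1 ▸ this, this⟩

variable (hS) in
lemma exists_exponents_eq_one : ∃ Δ : StructureMonoid S, ∀ y, exponents hS Δ y = 1 := by
  obtain ⟨Δ, h⟩ := exponents_surjective hS (Finsupp.equivFunOnFinite.symm fun _ => 1)
  exact ⟨Δ, fun y => by rw [h]; rfl⟩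

omit [Finite X] in
include hS in
lemma IsLeastGarsideElement.eq {Δ' : StructureMonoid S} (h : IsLeastGarsideElement Δ)
    (h' : IsLeastGarsideElement Δ') : Δ = Δ' :=
  exponents_injective hS <| le_antisymm
    ((mem_rightDivisors_iff hS _ _).1 (h.2 _ h'.1).2)
    ((mem_rightDivisors_iff hS _ _).1 (h'.2 _ h.1).2)

variable (hS) in
lemma IsLeastGarsideElement.exponents_eq_one (h : IsLeastGarsideElement Δ) (y : X) :
    exponents hS Δ y = 1 := by
  obtain ⟨Δ', h'⟩ := exists_exponents_eq_one hS
  rw [h.eq (hS := hS) (isLeastGarsideElement_of_exponents h')]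
  exact h' y

end GarsideElement

/-! ### Frozen pairs and property (C). -/

section FrozenPairs

variable {X : Type*} {S : X × X → X × X} (hS : IsNondegenerateSymmetric S)

lemma isFrozenPair_iff (x y : X) : IsFrozenPair S x y ↔ phi hS y y = x := by
  rw [phi_eq_iff]
  constructor
  · exact fun h => (congrArg Prod.snd h).symm
  · intro h
    have h1 := phi_f_eq_g hS x y
    rw [← h] at h1
    exact Prod.ext (h1.symm.trans ((phi_eq_iff hS _ _ _).2 h)) h.symm

/-- Put `T y = φ_y(y)`. Since `(T y, y)` is frozen, `g_{T y}(y) = T y`; so `T y = T z` makes one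
bijection `g_{T y}` agree at `y` and `z`. -/
lemma phi_diagonal_injective : Function.Injective fun y => phi hS y y := by
  have key : ∀ y, g S (phi hS y y) y = phi hS y y := fun y =>
    congrArg Prod.fst ((isFrozenPair_iff hS _ y).2 rfl)
  intro y z h
  apply (hS.g_bijective (phi hS y y)).injective
  have h' : phi hS y y = phi hS z z := h
  rw [key, h', key]

lemma phi_diagonal_g (x y : X) : phi hS (g S x y) (g S x y) = phi hS x (phi hS y y) := by
  rw [← Equiv.Perm.mul_apply, phi_mul, Equiv.Perm.mul_apply, phi_f_eq_g]

lemma propertyC_iff : PropertyC S ↔ ∀ y, phi hS (phi hS y y) * phi hS y = 1 := by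
  constructor
  · intro h y
    have h1 := (h _ _ ((isFrozenPair_iff hS _ y).2 rfl)).2
    rw [← inv_eq_one, mul_inv_rev]
    exact Equiv.ext fun z => congrFun h1 z
  · intro h x y hxy
    rw [isFrozenPair_iff hS] at hxy
    have h1 := h y
    rw [hxy] at h1
    constructor
    -- The map `T : y ↦ φ_y(y)` is injective and satisfies `T ∘ g_x = φ_x ∘ T`, which carries the
    -- identity on the `φ` over to the `g`.
    · funext z
      apply phi_diagonal_injective hS
      simp only [Function.comp_apply, phi_diagonal_g, id]
      exact Equiv.congr_fun h1 (phi hS z z)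
    · rw [← inv_eq_one, mul_inv_rev] at h1
      exact funext fun z => Equiv.congr_fun h1 z

lemma exponents_frozen (y : X) :
    exponents hS (gen S (phi hS y y) * gen S y) = Finsupp.single y 2 := by
  have := exponents_gen_perm_mul hS y (gen S y)
  rwa [perm_gen, exponents_gen, ← Finsupp.single_add] at this

lemma psiMonoid_frozen_eq_one_iff (y : X) :
    psiMonoid hS (gen S (phi hS y y) * gen S y) = 1 ↔ phi hS (phi hS y y) * phi hS y = 1 := by
  classical
  rw [← map_one (psiMonoid hS), psiMonoid_eq_iff, exponents_frozen]
  simp only [map_mul, map_one, perm_gen, exponents_one, and_iff_left_iff_imp]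
  intro _ z
  rw [Finsupp.single_apply]
  split_ifs <;> simp

lemma propertyC_of_image_eq_univ
    (h : psiMonoid hS '' {m | IsSimple hS m} = Set.univ) : PropertyC S := by
  classical
  rw [propertyC_iff hS]
  intro y
  rw [← psiMonoid_frozen_eq_one_iff]
  obtain ⟨m, hm, hmy⟩ : psiMonoid hS (gen S (phi hS y y) * gen S y) ∈
    psiMonoid hS '' {m | IsSimple hS m} := h ▸ Set.mem_univ _
  have h1 : m = 1 := by
    apply eq_one_of_exponents_eq_zero hS
    ext z
    have h2 := ((psiMonoid_eq_iff hS _ _).1 hmy).2 z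
    have h3 := hm z
    rw [exponents_frozen, Finsupp.single_apply] at h2
    split_ifs at h2 <;> simp <;> omega
  rw [← hmy, h1, map_one]

variable {hS}

/-- An exponent at least `2` at `y` means right divisibility by the frozen element of `y`, which `ψ`
kills; removing it lowers the size by `2`. -/
lemma PropertyC.exists_isSimple (hC : PropertyC S) (m : StructureMonoid S) :
    ∃ n, IsSimple hS n ∧ psiMonoid hS n = psiMonoid hS m := by
  generalize hk : size hS m = k
  induction k using Nat.strong_induction_on generalizing m with
  | _ k ih =>
    by_cases hm : IsSimple hS m
    · exact ⟨m, hm, rfl⟩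
    · obtain ⟨y, hy⟩ : ∃ y, 1 < exponents hS m y := by simpa [IsSimple] using hm
      obtain ⟨c, rfl⟩ : gen S (phi hS y y) * gen S y ∈ rightDivisors m := by
        rw [mem_rightDivisors_iff hS, exponents_frozen, Finsupp.single_le_iff]
        exact hy
      obtain ⟨n, hn, hnc⟩ := ih (size hS c) (by
        rw [← hk, size_mul, size_mul, size_gen, size_gen]; omega) c rfl
      exact ⟨n, hn, by
        rw [map_mul, (psiMonoid_frozen_eq_one_iff hS y).2 ((propertyC_iff hS).1 hC y), mul_one,
          hnc]⟩

lemma PropertyC.psiMonoid_surjective [Finite X] (hC : PropertyC S) :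
    Function.Surjective (psiMonoid hS) := by
  -- By finiteness `y ↦ φ_y(y)` is onto, so every `x` starts a frozen pair and `ψ_x` has an inverse
  -- among the generators.
  have hgen : ∀ x, ∃ y, psiMonoid hS (gen S x * gen S y) = 1 := by
    intro x
    obtain ⟨y, rfl⟩ := Finite.surjective_of_injective (phi_diagonal_injective hS) x
    exact ⟨y, (psiMonoid_frozen_eq_one_iff hS y).2 ((propertyC_iff hS).1 hC y)⟩
  have hinv : ∀ m, ∃ n, psiMonoid hS m * psiMonoid hS n = 1 := by
    intro m
    induction m using gen_induction with
    | one => exact ⟨1, by simp⟩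
    | mul x m ih =>
      obtain ⟨n, hn⟩ := ih
      obtain ⟨y, hy⟩ := hgen x
      refine ⟨n * gen S y, ?_⟩
      rw [map_mul, map_mul, mul_assoc, ← mul_assoc (psiMonoid hS m), hn, one_mul, ← map_mul, hy]
  rintro ⟨_, γ, rfl⟩
  suffices H : ∃ m, psiMonoid hS m = (psi hS).rangeRestrict γ from H
  have hγ : γ ∈ Subgroup.closure (Set.range (PresentedGroup.of : X → StructureGroup S)) := by
    rw [PresentedGroup.closure_range_of]
    trivial
  induction hγ using Subgroup.closure_induction with
  | mem γ h =>
    obtain ⟨x, rfl⟩ := h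
    exact ⟨gen S x, rfl⟩
  | one => exact ⟨1, by rw [map_one, map_one]; rfl⟩
  | mul γ δ _ _ hγ hδ =>
    obtain ⟨m, hm⟩ := hγ
    obtain ⟨n, hn⟩ := hδ
    exact ⟨m * n, by rw [map_mul, map_mul, hm, hn]; rfl⟩
  | inv γ _ hγ =>
    obtain ⟨m, hm⟩ := hγ
    obtain ⟨n, hn⟩ := hinv m
    exact ⟨n, by rw [map_inv, ← hm]; exact eq_inv_of_mul_eq_one_right hn⟩

lemma PropertyC.image_eq_univ [Finite X] (hC : PropertyC S) :
    psiMonoid hS '' {m | IsSimple hS m} = Set.univ := by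
  rw [Set.eq_univ_iff_forall]
  intro w
  obtain ⟨m, rfl⟩ := hC.psiMonoid_surjective (hS := hS) w
  exact hC.exists_isSimple m

end FrozenPairs

/-! ### The generated section. -/

section GeneratedSection

variable {X : Type*} [Finite X] {S : X × X → X × X} {hS : IsNondegenerateSymmetric S}
  {Δ : StructureMonoid S}

-- Shortest lifts of two complementary factors of `ψ(Δ)` multiply to a lift no longer than `Δ`,
-- which must be `Δ` itself. Hence each factor is the image of a divisor of `Δ`.
omit [Finite X] in
lemma propertyC_of_isGeneratingGeneratedSection (hΔ : ∀ y, exponents hS Δ y = 1)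
    (h : IsGeneratingGeneratedSection (generatorsW hS) (psiMonoid hS Δ) (StructureMonoid S)) :
    PropertyC S := by
  have hsurj := (closure_generatorsW_eq_top_iff hS).1 h.generates
  have hΔs : IsSimple hS Δ := fun y => (hΔ y).le
  apply propertyC_of_image_eq_univ hS
  rw [Set.eq_univ_iff_forall]
  intro v
  obtain ⟨v', hw, hl⟩ : v ∈ leftFactors (generatorsW hS) (psiMonoid hS Δ) :=
    h.factors_eq_univ ▸ Set.mem_univ v
  obtain ⟨a, rfl⟩ := hsurj v
  obtain ⟨b, rfl⟩ := hsurj v'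
  obtain ⟨m, hm, hml⟩ := exists_size_eq_length hS a
  obtain ⟨n, hn, hnl⟩ := exists_size_eq_length hS b
  have e : Δ = m * n := by
    apply hΔs.eq_of_size_le
    · rw [map_mul, hm, hn, hw]
    · rw [size_mul, hml, hnl, ← hl]
      exact length_psiMonoid_le hS Δ
  exact ⟨m, leftDivisors_subset_isSimple hΔ ⟨n, e⟩, hm⟩

lemma PropertyC.leftFactors_eq_univ (hC : PropertyC S) (hΔ : ∀ y, exponents hS Δ y = 1) :
    leftFactors (generatorsW hS) (psiMonoid hS Δ) = Set.univ := by
  have hΔs : IsSimple hS Δ := fun y => (hΔ y).le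
  rw [Set.eq_univ_iff_forall]
  intro v
  obtain ⟨m, hm, rfl⟩ : v ∈ psiMonoid hS '' {m | IsSimple hS m} :=
    hC.image_eq_univ ▸ Set.mem_univ v
  obtain ⟨c, rfl⟩ : m ∈ leftDivisors Δ := by rw [leftDivisors_eq_isSimple hΔ]; exact hm
  exact ⟨psiMonoid hS c, map_mul _ _ _, by
    rw [hΔs.length_eq, hm.length_eq, hΔs.of_mul_right.length_eq, size_mul]⟩

lemma PropertyC.rightFactors_eq_univ (hC : PropertyC S) (hΔ : ∀ y, exponents hS Δ y = 1) :
    rightFactors (generatorsW hS) (psiMonoid hS Δ) = Set.univ := by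
  have hΔs : IsSimple hS Δ := fun y => (hΔ y).le
  rw [Set.eq_univ_iff_forall]
  intro v
  obtain ⟨m, hm, rfl⟩ : v ∈ psiMonoid hS '' {m | IsSimple hS m} :=
    hC.image_eq_univ ▸ Set.mem_univ v
  obtain ⟨c, rfl⟩ : m ∈ rightDivisors Δ := by rw [rightDivisors_eq_isSimple hΔ]; exact hm
  exact ⟨psiMonoid hS c, map_mul _ _ _, by
    rw [hΔs.length_eq, hm.length_eq, hΔs.of_mul_left.length_eq, size_mul]⟩

omit [Finite X] in
lemma isSimple_gen_mul_gen {x y : X} (h : S (x, y) ≠ (x, y)) :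
    IsSimple hS (gen S x * gen S y) := by
  classical
  have h1 : (phi hS y)⁻¹ x ≠ y := fun e => h ((isFrozenPair_iff hS x y).2
    ((Equiv.Perm.inv_eq_iff_eq.1 e).symm))
  intro z
  rw [exponents_gen_mul, exponents_gen, perm_gen, Finsupp.add_apply, Finsupp.single_apply,
    Finsupp.single_apply]
  split_ifs with h2 h3
  · exact absurd (h3.trans h2.symm) h1
  all_goals simp

/-- The copy in the monoid of factors of `w` of the factor `v`, when all elements are factors. -/
def factor {W : Type*} [Group W] {A : Set W} {w : W} (h : leftFactors A w = Set.univ) (v : W) :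
    FactorMonoid A w :=
  PresentedMonoid.of (FactorRel A w) ⟨v, h ▸ Set.mem_univ v⟩

lemma factor_one {W : Type*} [Group W] {A : Set W} {w : W} (h : leftFactors A w = Set.univ) :
    factor h 1 = 1 :=
  PresentedMonoid.mk_eq_mk_of_rel (FactorRel.one ⟨1, _⟩ rfl)

lemma factor_mul {W : Type*} [Group W] {A : Set W} {w : W} (h : leftFactors A w = Set.univ)
    {v v' : W} (hl : length A v + length A v' = length A (v * v')) :
    factor h v * factor h v' = factor h (v * v') :=
  PresentedMonoid.mk_eq_mk_of_rel (FactorRel.mul ⟨v, _⟩ ⟨v', _⟩ ⟨v * v', _⟩ rfl hl)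

variable {w : groupW hS}

omit [Finite X] in
lemma IsSimple.factor_mul {m n : StructureMonoid S}
    (h : leftFactors (generatorsW hS) w = Set.univ) (hs : IsSimple hS (m * n)) :
    factor h (psiMonoid hS m) * factor h (psiMonoid hS n) = factor h (psiMonoid hS (m * n)) := by
  rw [map_mul]
  apply YangBaxter.factor_mul
  rw [← map_mul, hs.length_eq, hs.of_mul_left.length_eq, hs.of_mul_right.length_eq, size_mul]

/-- Inverse maps: a generator goes to the factor `ψ_x`, and a factor goes to its simple lift. The
first respects the relations because both sides of a non-frozen relation are simple. -/
lemma PropertyC.nonempty_mulEquiv (hC : PropertyC S)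
    (h : leftFactors (generatorsW hS) w = Set.univ) :
    Nonempty (StructureMonoid S ≃* FactorMonoid (generatorsW hS) w) := by
  have hex : ∀ v : groupW hS, ∃ m, IsSimple hS m ∧ psiMonoid hS m = v := by
    intro v
    obtain ⟨m, hm, e⟩ : v ∈ psiMonoid hS '' {m | IsSimple hS m} :=
      hC.image_eq_univ ▸ Set.mem_univ v
    exact ⟨m, hm, e⟩
  choose s hs hsv using hex
  let F : StructureMonoid S →* FactorMonoid (generatorsW hS) w :=
    PresentedMonoid.lift (fun x => factor h (psiMonoid hS (gen S x))) (by
      rintro _ _ ⟨x, y, hxy, rfl, rfl⟩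
      have h1 := isSimple_gen_mul_gen (hS := hS) hxy
      have h2 := h1
      rw [gen_mul_gen] at h2
      simp only [map_mul, FreeMonoid.lift_eval_of]
      rw [h1.factor_mul h, h2.factor_mul h, gen_mul_gen])
  let G : FactorMonoid (generatorsW hS) w →* StructureMonoid S :=
    PresentedMonoid.lift (rels := FactorRel (generatorsW hS) w)
      (fun v : leftFactors (generatorsW hS) w => s v) (by
      rintro _ _ (⟨e, he⟩ | ⟨v, v', v'', hv, hl⟩)
      · rw [FreeMonoid.lift_eval_of, map_one, he]
        exact (hs 1).eq (isSimple_one hS) (by rw [hsv, map_one])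
      · simp only [map_mul, FreeMonoid.lift_eval_of]
        -- Additivity of lengths gives the product of the two lifts the minimal size in its fibre,
        -- which forces it to be the simple lift.
        refine ((hs v'').eq_of_size_le (by rw [map_mul, hsv, hsv, hsv, hv]) ?_).symm
        rw [size_mul, ← (hs v).length_eq, ← (hs v').length_eq, ← (hs v'').length_eq, hsv, hsv, hsv,
          hl])
  have hF : ∀ m, IsSimple hS m → F m = factor h (psiMonoid hS m) := by
    intro m
    induction m using gen_induction with
    | one => exact fun _ => by rw [map_one, map_one, factor_one]
    | mul x m ih =>
      intro hm
      rw [map_mul, ih hm.of_mul_right, ← hm.factor_mul h]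
      rfl
  have hGF : G.comp F = MonoidHom.id _ := by
    ext x
    exact (hs _).eq (isSimple_gen hS x) (hsv _)
  have hFG : F.comp G = MonoidHom.id _ := by
    ext v
    exact (hF _ (hs v)).trans (by rw [hsv]; rfl)
  exact ⟨MonoidHom.toMulEquiv F G hGF hFG⟩

lemma PropertyC.isGeneratingGeneratedSection (hC : PropertyC S)
    (hΔ : ∀ y, exponents hS Δ y = 1) :
    IsGeneratingGeneratedSection (generatorsW hS) (psiMonoid hS Δ) (StructureMonoid S) where
  finite := Set.finite_univ_iff.1 (hC.image_eq_univ (hS := hS) ▸ (finite_isSimple hS).image _)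
  generates := (closure_generatorsW_eq_top_iff hS).2 hC.psiMonoid_surjective
  balanced := (hC.leftFactors_eq_univ hΔ).trans (hC.rightFactors_eq_univ hΔ).symm
  factors_generate := by rw [hC.leftFactors_eq_univ hΔ, Subgroup.closure_univ]
  iso := hC.nonempty_mulEquiv (hC.leftFactors_eq_univ hΔ)
  factors_eq_univ := hC.leftFactors_eq_univ hΔ

end GeneratedSection

end YangBaxter

open YangBaxter in
theorem mainTheorem2 {X : Type*} [Finite X] (S : X × X → X × X)
    (hS : YangBaxter.IsNondegenerateSymmetric S) :
    (∃! Δ : YangBaxter.StructureMonoid S, YangBaxter.IsLeastGarsideElement Δ) ∧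
    ∀ Δ : YangBaxter.StructureMonoid S, YangBaxter.IsLeastGarsideElement Δ →
      (YangBaxter.IsGeneratingGeneratedSection (YangBaxter.generatorsW hS)
          (YangBaxter.psiMonoid hS Δ) (YangBaxter.StructureMonoid S) ↔
        YangBaxter.PropertyC S) ∧
      (YangBaxter.psiMonoid hS '' YangBaxter.leftDivisors Δ = Set.univ ↔
        YangBaxter.PropertyC S) ∧
      (YangBaxter.PropertyC S → ∀ x y : X, YangBaxter.IsFrozenPair S x y →
        YangBaxter.toStructureGroup S
            (PresentedMonoid.of (YangBaxter.monoidRels S) x *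
              PresentedMonoid.of (YangBaxter.monoidRels S) y) ∈ (YangBaxter.psi hS).ker) := by
  constructor
  · obtain ⟨Δ, hΔ⟩ := exists_exponents_eq_one hS
    exact ⟨Δ, isLeastGarsideElement_of_exponents hΔ, fun Δ' h =>
      h.eq (hS := hS) (isLeastGarsideElement_of_exponents hΔ)⟩
  · intro Δ h
    have hΔ := h.exponents_eq_one hS
    refine ⟨⟨propertyC_of_isGeneratingGeneratedSection hΔ,
      fun hC => hC.isGeneratingGeneratedSection hΔ⟩, ?_, ?_⟩
    · rw [leftDivisors_eq_isSimple hΔ]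
      exact ⟨propertyC_of_image_eq_univ hS, fun hC => hC.image_eq_univ⟩
    · intro hC x y hxy
      obtain rfl := (isFrozenPair_iff hS x y).1 hxy
      exact congrArg Subtype.val
        ((psiMonoid_frozen_eq_one_iff hS y).2 ((propertyC_iff hS).1 hC y))
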